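/- Let $G$ be a finite simple graph that is outerplanar, i.e. $G$ has a drawing in the plane without crossings in which every vertex lies on the boundary of the outer (unbounded) face. In the Maker–Breaker domination game on $G$, two players, Dominator and Staller, alternately claim unclaimed vertices of $G$; Dominator wins if at some point the vertices she has claimed form a dominating set of $G$ (every vertex of $G$ is in the set or has a neighbour in it), and otherwise Staller wins. The outcome $o(G)$ is $\mathcal{D}$ if Dominator has a winning strategy whoever starts, $\mathcal{S}$ if Staller has a winning strategy whoever starts, and $\mathcal{N}$ if the player who starts has a winning strategy. Then $o(G)=\mathcal{D}$ if and only if $G$ has a perfect $[1,2]$-factor, that is, a spanning subgraph each of whose connected components is isomorphic to a single edge $K_2$ or to a cycle $C_n$ with $n\ge 3$. -/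

import Mathlib

/-! ### Plane drawings and outerplanar graphs -/

/-- A drawing of the graph `G` in the Euclidean plane (identified with `ℂ`) without crossings:
vertices are distinct points, every edge is a simple arc that joins its two end vertices and passes
through no other vertex, and two distinct edges do not meet except at common end vertices. -/
structure PlaneDrawing {V : Type*} (G : SimpleGraph V) where
  /-- the point that represents a vertex -/
  point : V → ℂ
  /-- the arc that represents an edge -/
  arc : G.edgeSet → C(unitInterval, ℂ)
  point_injective : Function.Injective point
  arc_injective : ∀ e, Function.Injective (arc e)
  arc_ends : ∀ e : G.edgeSet, s(arc e 0, arc e 1) = Sym2.map point e.1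
  arc_interior : ∀ e t v, arc e t = point v → t = 0 ∨ t = 1
  arc_disjoint : ∀ e f, e ≠ f → ∀ s t, arc e s = arc f t → s = 0 ∨ s = 1

/-- The set of all points of the plane covered by the drawing. -/
def PlaneDrawing.support {V : Type*} {G : SimpleGraph V} (P : PlaneDrawing G) : Set ℂ :=
  Set.range P.point ∪ ⋃ e, Set.range (P.arc e)

/-- The outer face of a drawing of a finite graph: the unbounded connected component of the
complement of the drawing. -/
def PlaneDrawing.outerFace {V : Type*} {G : SimpleGraph V} (P : PlaneDrawing G) : Set ℂ :=
  {z | z ∈ P.supportᶜ ∧ ¬ Bornology.IsBounded (connectedComponentIn P.supportᶜ z)}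

/-- A graph is outerplanar if it has a plane drawing in which every vertex lies on the boundary of
the outer face. -/
def IsOuterplanar {V : Type*} (G : SimpleGraph V) : Prop :=
  ∃ P : PlaneDrawing G, ∀ v, P.point v ∈ frontier P.outerFace

/-! ### The Maker-Breaker domination game -/

/-- `D` is a dominating set: every closed neighbourhood meets `D`. -/
def IsDominatingSet {V : Type*} (G : SimpleGraph V) (D : Finset V) : Prop :=
  ∀ v, ∃ x ∈ D, x = v ∨ G.Adj v x

/-- The two players of the game. -/
inductive Player
  | dominator
  | staller

/-- `DominatorWins G p D S`: Dominator has a winning strategy from the position in which she has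
claimed the vertices in `D`, Staller has claimed those in `S`, and it is the turn of player `p`.
Dominator has won once `D` is dominating; otherwise the player whose turn it is claims
an unclaimed vertex, and Dominator has lost if no vertex is left. -/
inductive DominatorWins {V : Type*} [DecidableEq V] (G : SimpleGraph V) :
    Player → Finset V → Finset V → Prop
  | won (p : Player) (D S : Finset V) (h : IsDominatingSet G D) : DominatorWins G p D S
  | dominator_move (D S : Finset V) (v : V) (hv : v ∉ D ∪ S)
      (h : DominatorWins G Player.staller (insert v D) S) :
      DominatorWins G Player.dominator D S
  | staller_move (D S : Finset V) (hne : ∃ v, v ∉ D ∪ S)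
      (h : ∀ v, v ∉ D ∪ S → DominatorWins G Player.dominator D (insert v S)) :
      DominatorWins G Player.staller D S

/-- The possible outcomes: Dominator wins whoever starts (`D`), Staller wins whoever starts (`S`),
the player who starts wins (`N`). -/
inductive Outcome
  | D
  | S
  | N

open Classical in
/-- The outcome of the domination game on a finite graph, with all vertices unclaimed at the
beginning. The game is finite and has no draws, so Staller wins exactly when Dominator does not;
and since an additional move never harms a player, the remaining case is the one in
which each player wins when starting. -/
noncomputable def outcome {V : Type*} [DecidableEq V] (G : SimpleGraph V) : Outcome :=
  if DominatorWins G Player.dominator ∅ ∅ ∧ DominatorWins G Player.staller ∅ ∅ then Outcome.D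
  else if ¬ DominatorWins G Player.dominator ∅ ∅ ∧ ¬ DominatorWins G Player.staller ∅ ∅ then
    Outcome.S
  else Outcome.N

/-! ### Perfect `[1,2]`-factors -/

/-- `K` is isomorphic to the single edge `K₂` or to a cycle `Cₙ` with `n ≥ 3`. -/
def IsEdgeOrCycle {W : Type*} (K : SimpleGraph W) : Prop :=
  Nonempty (K ≃g (⊤ : SimpleGraph (Fin 2))) ∨
    ∃ n : ℕ, 3 ≤ n ∧ Nonempty (K ≃g SimpleGraph.cycleGraph n)

/-- `H` is a perfect `[1,2]`-factor of `G`: a spanning subgraph each of whose connected components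
is an edge or a cycle. -/
def IsPerfectOneTwoFactor {V : Type*} (G H : SimpleGraph V) : Prop :=
  H ≤ G ∧ ∀ C : H.ConnectedComponent, IsEdgeOrCycle C.toSimpleGraph

/-!
Dominator wins as second player on an outerplanar graph exactly when the graph has a perfect
`[1,2]`-factor. Such a factor is the same thing as an injective map `s` with `v` adjacent to `s v`
for every vertex `v` (`exists_isPerfectOneTwoFactor_iff`): orient the cycles, or take the orbits of
`s`. By Hall's theorem it exists unless some set of vertices has too few neighbours.

Given `s`, Dominator keeps the invariant that the undominated vertices `v` and their images `s v`
are unclaimed (`IsReservation`). Whatever Staller claims, one move of Dominator restores it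
(`IsReservation.exists_answer`), and no parity of cycles enters. Here `G` may be any finite graph.

If there is no such `s`, Hall's condition yields an independent set `I` whose neighbourhood `X` is
smaller than `I`, and Staller, moving first, claims a whole closed neighbourhood of a vertex of `I`
(`IsDeficient.not_dominatorWins`). He proceeds by induction: if `c ∈ X` is a vertex such that `I`
and `X \ {c}` split into two deficient pairs with no other neighbours than `c`, he claims `c`.
Dominator can answer in one of the two pairs only, and the other remains deficient.

Such a `c` exists when `(I, X)` is minimal (`exists_deficient_split`). Suppose there is none;
then no `c ∈ X` separates vertices of `I` (`reachable_avoid_of_minimal`), so the bipartite graph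
between `I` and `X` has a cycle. Let `C` be a longest one. It contains equally many vertices of
both sides, so some component of the rest has more vertices in `I` than in `X`; by minimality it is
adjacent to some `x ∈ X` on `C`, and since `x` does not separate, to another vertex of `C` as well.
If this is a neighbour of `x` on `C`, the cycle can be lengthened. If not, there are three paths of
length at least two between two vertices (`IsCyclicSeq.false_of_ear`), which an outerplanar graph
does not contain (`IsOuterplanar.noThetaAt`).

For this topological fact, a point of the outer face is connected with an inner vertex of each of
the three paths. The result is a drawing of `K₃,₃` in which edges without a common end are disjoint.
It is excluded without the Jordan curve theorem (`not_exists_drawing_K33`): for disjoint arcs `f`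
and `g`, the function `f s - g t` has a continuous logarithm on the square, so the changes of
argument along its four sides cancel (`log_increment_square`). Relative to fixed arguments of the
differences of vertices, these are integer equations, one for each of the eighteen pairs of edges
without a common end, and their sum is contradictory modulo two.
-/

/-! ### Continuous logarithms and the complete bipartite graph on three and three vertices -/

theorem exists_continuous_log {X : Type*} [TopologicalSpace X] [SimplyConnectedSpace X]
    [LocallyPathConnectedSpace X] {f : X → ℂ} (hf : Continuous f) (h0 : ∀ x, f x ≠ 0) :
    ∃ L : X → ℂ, Continuous L ∧ ∀ x, Complex.exp (L x) = f x := by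
  obtain ⟨x₀⟩ := (inferInstance : Nonempty X)
  obtain ⟨F, ⟨-, hF⟩, -⟩ := Complex.isCoveringMap_exp.existsUnique_continuousMap_lifts
    (⟨fun x => ⟨f x, h0 x⟩, by fun_prop⟩ : C(X, {z : ℂ // z ≠ 0})) x₀ (Complex.log (f x₀))
    (by ext; exact Complex.exp_log (h0 x₀))
  exact ⟨F, F.continuous, fun x => congrArg Subtype.val (congrFun hF x)⟩

/-- Two continuous logarithms of functions that differ by a constant factor have the same
increments: their difference takes values in a coset of the discrete group `2πiℤ`. -/
theorem log_increment_unique {L M : ℝ → ℂ} (hL : Continuous L) (hM : Continuous M) (c : ℂ)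
    (h : ∀ x, Complex.exp (L x) = c * Complex.exp (M x)) (x y : ℝ) :
    L y - L x = M y - M x := by
  have hk : ∀ t, ∃ n : ℤ, L t - M t = L 0 - M 0 + n * (2 * Real.pi * Complex.I) := by
    intro t
    refine Complex.exp_eq_exp_iff_exists_int.1 ?_
    rw [Complex.exp_sub, Complex.exp_sub, h, h, mul_div_cancel_right₀ _ (Complex.exp_ne_zero _),
      mul_div_cancel_right₀ _ (Complex.exp_ne_zero _)]
  choose n hn using hk
  have hpi : (2 * Real.pi : ℂ) ≠ 0 := by
    simp [Real.pi_ne_zero]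
  have hcont : Continuous n := by
    have h1 : Continuous fun t => ((n t : ℤ) : ℝ) := by
      have h2 : (fun t => ((n t : ℤ) : ℝ)) =
          fun t => ((L t - M t - (L 0 - M 0)) / (2 * Real.pi * Complex.I)).re := by
        ext t
        rw [hn t, add_sub_cancel_left, mul_div_cancel_right₀ _ (mul_ne_zero hpi Complex.I_ne_zero)]
        simp
      rw [h2]
      fun_prop
    exact Int.isClosedEmbedding_coe_real.isInducing.continuous_iff.2 h1
  have hxy : n x = n y := PreconnectedSpace.constant inferInstance hcont
  linear_combination hn y - hn x - (2 * Real.pi * Complex.I) * (congrArg (Int.cast : ℤ → ℂ) hxy)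

/-- The total change of a continuous argument of `f s - g t` along the boundary of the unit square
vanishes. The four sides are expressed by arbitrary logarithms; for the sides on which `s` is
constant the opposite function `g t - f s` is used. -/
theorem log_increment_square {f g : ℝ → ℂ} (hf : Continuous f) (hg : Continuous g)
    (h : ∀ s t, f s ≠ g t) {La Lb Lc Ld : ℝ → ℂ} (ca : Continuous La) (cb : Continuous Lb)
    (cc : Continuous Lc) (cd : Continuous Ld) (ha : ∀ s, Complex.exp (La s) = f s - g 0)
    (hb : ∀ s, Complex.exp (Lb s) = f s - g 1) (hc : ∀ t, Complex.exp (Lc t) = g t - f 0)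
    (hd : ∀ t, Complex.exp (Ld t) = g t - f 1) :
    (La 1 - La 0) + (Ld 1 - Ld 0) = (Lb 1 - Lb 0) + (Lc 1 - Lc 0) := by
  obtain ⟨L, cL, hL⟩ := exists_continuous_log (X := ℝ × ℝ) (f := fun x => f x.1 - g x.2)
    (by fun_prop) (fun x => sub_ne_zero.2 (h _ _))
  have h1 := log_increment_unique ca (M := fun s => L (s, 0)) (by fun_prop) 1
    (fun s => by rw [ha, hL, one_mul]) 0 1
  have h2 := log_increment_unique cb (M := fun s => L (s, 1)) (by fun_prop) 1
    (fun s => by rw [hb, hL, one_mul]) 0 1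
  have h3 := log_increment_unique cc (M := fun t => L (0, t)) (by fun_prop) (-1)
    (fun s => by rw [hc, hL]; ring) 0 1
  have h4 := log_increment_unique cd (M := fun t => L (1, t)) (by fun_prop) (-1)
    (fun s => by rw [hd, hL]; ring) 0 1
  rw [h1, h2, h3, h4]
  ring

theorem exists_antisymmetric_log {Q : Fin 3 → ℂ} (hQ : Function.Injective Q) :
    ∃ b : Fin 3 → Fin 3 → ℂ, (∀ l m, l ≠ m → Complex.exp (b l m) = Q l - Q m) ∧
      ∀ l m, l < m → b m l = b l m + Real.pi * Complex.I := by
  refine ⟨fun l m => if l < m then Complex.log (Q l - Q m)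
    else Complex.log (Q m - Q l) + Real.pi * Complex.I, fun l m hlm => ?_, fun l m hlm => ?_⟩
  · dsimp only
    split_ifs with h
    · exact Complex.exp_log (sub_ne_zero.2 (hQ.ne hlm))
    · rw [Complex.exp_add, Complex.exp_log (sub_ne_zero.2 (hQ.ne hlm.symm)), Complex.exp_pi_mul_I]
      ring
  · simp only [hlm, if_true, if_neg hlm.not_gt]

/-- The complete bipartite graph `K₃,₃` is not planar, in the strong form that even drawings in
which adjacent edges may meet, and edges need not be simple, have two disjoint edges that meet. -/
theorem not_exists_drawing_K33 (E : Fin 3 → Fin 3 → Set ℂ) (P A : Fin 3 → ℂ)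
    (hE : ∀ l r, JoinedIn (E l r) (P l) (A r))
    (hd : ∀ l l' r r', l ≠ l' → r ≠ r' → Disjoint (E l r) (E l' r')) : False := by
  set g : Fin 3 → Fin 3 → ℝ → ℂ := fun l r => (hE l r).somePath.extend with hg
  have gc : ∀ l r, Continuous (g l r) := fun l r => (hE l r).somePath.continuous_extend
  have g0 : ∀ l r, g l r 0 = P l := fun l r => by simp [hg]
  have g1 : ∀ l r, g l r 1 = A r := fun l r => by simp [hg]
  have gE : ∀ l r t, g l r t ∈ E l r := fun l r t => (hE l r).somePath_mem _
  have gd : ∀ l l' r r', l ≠ l' → r ≠ r' → ∀ s t, g l r s ≠ g l' r' t :=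
    fun l l' r r' hl hr s t => (hd l l' r r' hl hr).ne_of_mem (gE ..) (gE ..)
  have other : ∀ r : Fin 3, ∃ r', r ≠ r' := by decide
  have hP : Function.Injective P := by
    intro l l' h
    by_contra hl
    apply gd l l' 0 1 hl (by decide) 0 0
    rw [g0, g0, h]
  have hA : Function.Injective A := by
    intro r r' h
    by_contra hr
    apply gd 0 1 r r' (by decide) hr 1 1
    rw [g1, g1, h]
  have hPA : ∀ l r, P l ≠ A r := by
    intro l r
    obtain ⟨l', hl⟩ := other l
    obtain ⟨r', hr⟩ := other r
    rw [← g0 l r', ← g1 l' r]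
    exact gd _ _ _ _ hl hr.symm _ _
  have exLP : ∀ m l r, ∃ L : ℝ → ℂ, m ≠ l →
      Continuous L ∧ ∀ s, Complex.exp (L s) = g l r s - P m := by
    intro m l r
    by_cases hm : m = l
    · exact ⟨0, fun h => absurd hm h⟩
    · obtain ⟨r', hr⟩ := other r
      obtain ⟨L, h⟩ := exists_continuous_log (f := fun s => g l r s - P m)
        ((gc l r).sub continuous_const) (fun s => by
          rw [sub_ne_zero, ← g0 m r']; exact gd _ _ _ _ (Ne.symm hm) hr _ _)
      exact ⟨L, fun _ => h⟩
  have exLA : ∀ m l r, ∃ L : ℝ → ℂ, m ≠ r →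
      Continuous L ∧ ∀ s, Complex.exp (L s) = g l r s - A m := by
    intro m l r
    by_cases hm : m = r
    · exact ⟨0, fun h => absurd hm h⟩
    · obtain ⟨l', hl⟩ := other l
      obtain ⟨L, h⟩ := exists_continuous_log (f := fun s => g l r s - A m)
        ((gc l r).sub continuous_const) (fun s => by
          rw [sub_ne_zero, ← g1 l' m]; exact gd _ _ _ _ hl (Ne.symm hm) _ _)
      exact ⟨L, fun _ => h⟩
  choose LP hLP using exLP
  choose LA hLA using exLA
  obtain ⟨b, hb, hb'⟩ := exists_antisymmetric_log hP
  obtain ⟨c, hc, hc'⟩ := exists_antisymmetric_log hA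
  set a : Fin 3 → Fin 3 → ℂ := fun l r => Complex.log (P l - A r)
  have ha : ∀ l r, Complex.exp (a l r) = P l - A r :=
    fun l r => Complex.exp_log (sub_ne_zero.2 (hPA l r))
  have ha' : ∀ l r, Complex.exp (a l r + Real.pi * Complex.I) = A r - P l := by
    intro l r
    rw [Complex.exp_add, ha, Complex.exp_pi_mul_I]
    ring
  -- each increment is the difference of the reference logarithms up to a multiple of `2πi`
  have exnP : ∀ m l r, ∃ n : ℤ, m ≠ l → LP m l r 1 - LP m l r 0 =
      a m r + Real.pi * Complex.I - b l m + n * (2 * Real.pi * Complex.I) := by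
    intro m l r
    by_cases hm : m = l
    · exact ⟨0, fun h => absurd hm h⟩
    · obtain ⟨n, hn⟩ := Complex.exp_eq_exp_iff_exists_int.1
        (show Complex.exp (LP m l r 1 - LP m l r 0) =
          Complex.exp (a m r + Real.pi * Complex.I - b l m) by
          rw [Complex.exp_sub, Complex.exp_sub, (hLP m l r hm).2, (hLP m l r hm).2, ha',
            hb l m (Ne.symm hm), g0, g1])
      exact ⟨n, fun _ => hn⟩
  have exnA : ∀ m l r, ∃ n : ℤ, m ≠ r → LA m l r 1 - LA m l r 0 =
      c r m - a l m + n * (2 * Real.pi * Complex.I) := by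
    intro m l r
    by_cases hm : m = r
    · exact ⟨0, fun h => absurd hm h⟩
    · obtain ⟨n, hn⟩ := Complex.exp_eq_exp_iff_exists_int.1
        (show Complex.exp (LA m l r 1 - LA m l r 0) = Complex.exp (c r m - a l m) by
          rw [Complex.exp_sub, Complex.exp_sub, (hLA m l r hm).2, (hLA m l r hm).2, ha,
            hc r m (Ne.symm hm), g0, g1])
      exact ⟨n, fun _ => hn⟩
  choose nP hnP using exnP
  choose nA hnA using exnA
  have sq : ∀ l l' r r', l ≠ l' → r ≠ r' → b l' l - b l l' + (c r' r - c r r') +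
      ((nP l' l r + nA r l' r' - nA r' l r - nP l l' r' : ℤ) : ℂ) * (2 * Real.pi * Complex.I)
        = 0 := by
    intro l l' r r' hl hr
    have h := log_increment_square (gc l r) (gc l' r') (gd l l' r r' hl hr)
      (hLP l' l r hl.symm).1 (hLA r' l r hr.symm).1 (hLP l l' r' hl).1 (hLA r l' r' hr).1
      (by rw [g0]; exact (hLP l' l r hl.symm).2) (by rw [g1]; exact (hLA r' l r hr.symm).2)
      (by rw [g0]; exact (hLP l l' r' hl).2) (by rw [g1]; exact (hLA r l' r' hr).2)
    rw [hnP _ _ _ hl.symm, hnP _ _ _ hl, hnA _ _ _ hr.symm, hnA _ _ _ hr] at h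
    push_cast
    linear_combination h
  have hpi : (2 * Real.pi * Complex.I : ℂ) ≠ 0 := by
    simp [Real.pi_ne_zero]
  have e1 : ∀ l l' r r', l < l' → r < r' →
      nP l' l r + nA r l' r' - nA r' l r - nP l l' r' = -1 := by
    intro l l' r r' hl hr
    have h := sq l l' r r' hl.ne hr.ne
    rw [hb' _ _ hl, hc' _ _ hr] at h
    have h2 : ((nP l' l r + nA r l' r' - nA r' l r - nP l l' r' : ℤ) : ℂ) = ((-1 : ℤ) : ℂ) :=
      mul_right_cancel₀ hpi (by push_cast at h ⊢; linear_combination h)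
    exact_mod_cast h2
  have e2 : ∀ l l' r r', l < l' → r' < r →
      nP l' l r + nA r l' r' - nA r' l r - nP l l' r' = 0 := by
    intro l l' r r' hl hr
    have h := sq l l' r r' hl.ne hr.ne'
    rw [hb' _ _ hl, hc' _ _ hr] at h
    have h2 : ((nP l' l r + nA r l' r' - nA r' l r - nP l l' r' : ℤ) : ℂ) = ((0 : ℤ) : ℂ) :=
      mul_right_cancel₀ hpi (by push_cast at h ⊢; linear_combination h)
    exact_mod_cast h2
  -- every integer occurs twice in the sum of the eighteen equations, whose right side is `-9`
  have f01 := e1 0 1 0 1 (by decide) (by decide)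
  have f02 := e1 0 1 0 2 (by decide) (by decide)
  have f03 := e1 0 1 1 2 (by decide) (by decide)
  have f04 := e1 0 2 0 1 (by decide) (by decide)
  have f05 := e1 0 2 0 2 (by decide) (by decide)
  have f06 := e1 0 2 1 2 (by decide) (by decide)
  have f07 := e1 1 2 0 1 (by decide) (by decide)
  have f08 := e1 1 2 0 2 (by decide) (by decide)
  have f09 := e1 1 2 1 2 (by decide) (by decide)
  have f11 := e2 0 1 1 0 (by decide) (by decide)
  have f12 := e2 0 1 2 0 (by decide) (by decide)
  have f13 := e2 0 1 2 1 (by decide) (by decide)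
  have f14 := e2 0 2 1 0 (by decide) (by decide)
  have f15 := e2 0 2 2 0 (by decide) (by decide)
  have f16 := e2 0 2 2 1 (by decide) (by decide)
  have f17 := e2 1 2 1 0 (by decide) (by decide)
  have f18 := e2 1 2 2 0 (by decide) (by decide)
  have f19 := e2 1 2 2 1 (by decide) (by decide)
  clear e1 e2
  omega

/-! ### Subgraph drawings and the outer face -/

/-- The part of a drawing that represents the subgraph induced by `S`. -/
def PlaneDrawing.supportOn {V : Type*} {G : SimpleGraph V} (P : PlaneDrawing G) (S : Set V) :
    Set ℂ :=
  P.point '' S ∪ ⋃ e ∈ {e : G.edgeSet | ∀ v ∈ e.1, v ∈ S}, Set.range (P.arc e)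

section Drawing

variable {V : Type*} {G : SimpleGraph V} (P : PlaneDrawing G)

theorem PlaneDrawing.mem_supportOn {S : Set V} {z : ℂ} : z ∈ P.supportOn S ↔
    (∃ v ∈ S, P.point v = z) ∨ ∃ e : G.edgeSet, (∀ v ∈ e.1, v ∈ S) ∧ ∃ t, P.arc e t = z := by
  simp [PlaneDrawing.supportOn]

theorem PlaneDrawing.supportOn_mono {S T : Set V} (h : S ⊆ T) :
    P.supportOn S ⊆ P.supportOn T := by
  intro z
  simp only [P.mem_supportOn]
  rintro (⟨v, hv, rfl⟩ | ⟨e, he, ht⟩)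
  · exact Or.inl ⟨v, h hv, rfl⟩
  · exact Or.inr ⟨e, fun v hv => h (he v hv), ht⟩

theorem PlaneDrawing.supportOn_univ : P.supportOn Set.univ = P.support := by
  ext z
  simp [P.mem_supportOn, PlaneDrawing.support]

theorem PlaneDrawing.isCompact_supportOn [Finite V] (S : Set V) : IsCompact (P.supportOn S) := by
  refine ((Set.toFinite S).image P.point).isCompact.union ?_
  exact (Set.toFinite _).isCompact_biUnion fun e _ => isCompact_range (P.arc e).continuous

theorem PlaneDrawing.exists_point_eq_arc_end (e : G.edgeSet) {t : unitInterval}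
    (ht : t = 0 ∨ t = 1) : ∃ v ∈ e.1, P.arc e t = P.point v := by
  have h : P.arc e t ∈ s(P.arc e 0, P.arc e 1) := by
    rcases ht with rfl | rfl <;> simp
  rw [P.arc_ends, Sym2.mem_map] at h
  obtain ⟨v, hv, h⟩ := h
  exact ⟨v, hv, h.symm⟩

theorem PlaneDrawing.point_mem_supportOn {S : Set V} {v : V} (h : P.point v ∈ P.supportOn S) :
    v ∈ S := by
  rcases P.mem_supportOn.1 h with ⟨w, hw, h⟩ | ⟨e, he, t, h⟩
  · rwa [← P.point_injective h]
  · obtain ⟨w, hw, h'⟩ := P.exists_point_eq_arc_end e (P.arc_interior e t v h)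
    rw [← P.point_injective (h'.symm.trans h)]
    exact he w hw

theorem PlaneDrawing.disjoint_supportOn {S T : Set V} (h : Disjoint S T) :
    Disjoint (P.supportOn S) (P.supportOn T) := by
  rw [Set.disjoint_left] at h ⊢
  intro z hS hT
  rcases P.mem_supportOn.1 hS with ⟨v, hv, rfl⟩ | ⟨e, he, s, rfl⟩
  · exact h hv (P.point_mem_supportOn hT)
  · have key : (s = 0 ∨ s = 1) → False := fun hs => by
      obtain ⟨v, hv, h'⟩ := P.exists_point_eq_arc_end e hs
      rw [h'] at hT
      exact h (he v hv) (P.point_mem_supportOn hT)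
    rcases P.mem_supportOn.1 hT with ⟨v, hv, h'⟩ | ⟨f, hf, t, h'⟩
    · exact key (P.arc_interior e s v h'.symm)
    · refine key (P.arc_disjoint e f ?_ s t h'.symm)
      rintro rfl
      obtain ⟨⟨v, w⟩⟩ := e
      exact h (he v (Sym2.mem_mk_left v w)) (hf v (Sym2.mem_mk_left v w))

theorem PlaneDrawing.joinedIn_of_adj {S : Set V} {v w : V} (h : G.Adj v w) (hv : v ∈ S)
    (hw : w ∈ S) : JoinedIn (P.supportOn S) (P.point v) (P.point w) := by
  set e : G.edgeSet := ⟨s(v, w), h⟩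
  have he : ∀ u ∈ e.1, u ∈ S := by
    intro u hu
    rcases Sym2.mem_iff.1 hu with rfl | rfl <;> assumption
  have h01 : JoinedIn (P.supportOn S) (P.arc e 0) (P.arc e 1) :=
    ⟨⟨P.arc e, rfl, rfl⟩, fun t => P.mem_supportOn.2 (Or.inr ⟨e, he, t, rfl⟩)⟩
  have hends : s(P.arc e 0, P.arc e 1) = s(P.point v, P.point w) := P.arc_ends e
  rcases Sym2.eq_iff.1 hends with ⟨h0, h1⟩ | ⟨h0, h1⟩
  · rwa [h0, h1] at h01
  · rw [h0, h1] at h01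
    exact h01.symm

theorem PlaneDrawing.joinedIn_of_walk {S : Set V} {v w : V} (p : G.Walk v w)
    (hp : ∀ u ∈ p.support, u ∈ S) : JoinedIn (P.supportOn S) (P.point v) (P.point w) := by
  induction p with
  | nil => exact JoinedIn.refl (P.mem_supportOn.2 (Or.inl ⟨_, hp _ (by simp), rfl⟩))
  | cons h q ih =>
    refine (P.joinedIn_of_adj h (hp _ (by simp)) (hp _ (by simp))).trans
      (ih fun u hu => hp u (by simp [hu]))

/-- The complement of a disc in the plane is path connected, being the image of a half plane under
polar coordinates. -/
theorem isPathConnected_compl_closedBall_zero {R : ℝ} (hR : 0 ≤ R) :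
    IsPathConnected (Metric.closedBall (0 : ℂ) R)ᶜ := by
  have h1 : IsPathConnected (Set.Ioi R ×ˢ (Set.univ : Set ℝ)) :=
    ((convex_Ioi R).prod convex_univ).isPathConnected ⟨(R + 1, 0), by simp⟩
  have h2 := h1.image (f := fun x : ℝ × ℝ => (x.1 : ℂ) * Complex.exp (x.2 * Complex.I))
    (by fun_prop)
  convert h2 using 1
  ext z
  simp only [Set.mem_compl_iff, Metric.mem_closedBall, dist_zero_right, not_le, Set.mem_image,
    Set.mem_prod, Set.mem_Ioi, Set.mem_univ, and_true, Prod.exists]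
  constructor
  · exact fun h => ⟨‖z‖, z.arg, h, Complex.norm_mul_exp_arg_mul_I z⟩
  · rintro ⟨r, t, hr, rfl⟩
    rwa [norm_mul, Complex.norm_exp_ofReal_mul_I, mul_one, Complex.norm_real, Real.norm_eq_abs,
      abs_of_pos (hR.trans_lt hr)]

/-- The outer face is connected by paths: a bounded drawing has only one unbounded face. -/
theorem PlaneDrawing.joinedIn_compl_support [Finite V] {z w : ℂ} (hz : z ∈ P.outerFace)
    (hw : w ∈ P.outerFace) : JoinedIn P.supportᶜ z w := by
  have hc : IsCompact P.support := P.supportOn_univ ▸ P.isCompact_supportOn _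
  obtain ⟨R, hR0, hR⟩ : ∃ R : ℝ, 0 ≤ R ∧ P.support ⊆ Metric.closedBall 0 R := by
    obtain ⟨R, hR⟩ := hc.isBounded.subset_closedBall 0
    exact ⟨max R 0, le_max_right _ _, hR.trans (Metric.closedBall_subset_closedBall
      (le_max_left _ _))⟩
  have far : ∀ z ∈ P.outerFace, ∃ z' ∈ (Metric.closedBall (0 : ℂ) R)ᶜ,
      JoinedIn P.supportᶜ z z' := by
    intro z hz
    obtain ⟨z', hz', hz''⟩ : ∃ z' ∈ connectedComponentIn P.supportᶜ z,
        z' ∉ Metric.closedBall (0 : ℂ) R := by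
      by_contra! h
      exact hz.2 (Metric.isBounded_closedBall.subset h)
    have ho : IsOpen (connectedComponentIn P.supportᶜ z) :=
      hc.isClosed.isOpen_compl.connectedComponentIn
    have hpc := ho.isConnected_iff_isPathConnected.1
      (isConnected_connectedComponentIn_iff.2 hz.1)
    exact ⟨z', hz'', (hpc.joinedIn z (mem_connectedComponentIn hz.1) z' hz').mono
      (connectedComponentIn_subset _ _)⟩
  obtain ⟨z', hz', hzz⟩ := far z hz
  obtain ⟨w', hw', hww⟩ := far w hw
  have h := ((isPathConnected_compl_closedBall_zero hR0).joinedIn z' hz' w' hw').mono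
    (Set.compl_subset_compl.2 hR)
  exact (hzz.trans h).trans hww.symm

end Drawing

/-- `G` has no `K₂,₃` minor of the following kind: one of the two branch sets of degree three is a
single vertex `p`, those of degree two are single vertices `a i`, and the other branch set
lies in a set `Q` such that some `q ∈ Q` is joined to each `a i` by a walk in `Q ∪ {a i}`. -/
def NoThetaAt {V : Type*} (G : SimpleGraph V) : Prop :=
  ∀ (p q : V) (a : Fin 3 → V) (Q : Set V), Function.Injective a → p ∉ Q → q ∈ Q →
    (∀ i, G.Adj p (a i)) → (∀ i, a i ∉ Q) →
    (∀ i, ∃ w : G.Walk q (a i), ∀ u ∈ w.support, u ∈ insert (a i) Q) → False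

theorem NoThetaAt.mono {V : Type*} {G H : SimpleGraph V} (hG : NoThetaAt G)
    (h : H ≤ G) : NoThetaAt H := by
  intro p q a Q ha hp hq hpa haQ hw
  refine hG p q a Q ha hp hq (fun i => h (hpa i)) haQ fun i => ?_
  obtain ⟨w, hw⟩ := hw i
  exact ⟨w.mapLe h, by simpa using hw⟩

/-- A forbidden minor of an outerplanar graph together with a point of the outer face, which can be
connected to each of the vertices `a i`, would be a drawing of `K₃,₃`. -/
theorem IsOuterplanar.noThetaAt {V : Type*} [Finite V] {G : SimpleGraph V}
    (hG : IsOuterplanar G) : NoThetaAt G := by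
  obtain ⟨P, hP⟩ := hG
  intro p q a Q ha hpQ hqQ hpa haQ hw
  -- near `a i` the drawing consists of edges at `a i` only
  have hball : ∀ i, ∃ r > 0, Disjoint (Metric.ball (P.point (a i)) r) (P.supportOn {a i}ᶜ) := by
    intro i
    obtain ⟨r, hr, h⟩ := Metric.isOpen_iff.1 (P.isCompact_supportOn {a i}ᶜ).isClosed.isOpen_compl
      (P.point (a i)) (fun h => P.point_mem_supportOn h rfl)
    exact ⟨r, hr, Set.disjoint_left.2 h⟩
  choose r hr hB using hball
  have hz : ∀ i, ∃ z ∈ P.outerFace, z ∈ Metric.ball (P.point (a i)) (r i) := by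
    intro i
    obtain ⟨z, hz, h⟩ := Metric.mem_closure_iff.1 (frontier_subset_closure (hP (a i))) _ (hr i)
    exact ⟨z, hz, by rwa [Metric.mem_ball, dist_comm]⟩
  choose z hzU hzB using hz
  -- through the outer face from `z 0` to `z i`, then straight to `a i`
  have hU : ∀ i, JoinedIn (P.supportᶜ ∪ Metric.ball (P.point (a i)) (r i)) (z 0)
      (P.point (a i)) := by
    intro i
    have h1 := P.joinedIn_compl_support (hzU 0) (hzU i)
    have h2 := ((convex_ball (P.point (a i)) (r i)).isPathConnected ⟨_, hzB i⟩).joinedIn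
      (z i) (hzB i) (P.point (a i)) (Metric.mem_ball_self (hr i))
    exact (h1.mono Set.subset_union_left).trans (h2.mono Set.subset_union_right)
  have hne : ∀ i, p ≠ a i := fun i => (hpa i).ne
  have hpp : ∀ i j, i ≠ j → Disjoint (P.supportᶜ ∪ Metric.ball (P.point (a i)) (r i))
      (P.supportOn {p, a j}) := by
    intro i j hij
    refine Set.disjoint_union_left.2 ⟨?_, (hB i).mono_right (P.supportOn_mono ?_)⟩
    · rw [← P.supportOn_univ]
      exact disjoint_compl_left.mono_right (P.supportOn_mono (Set.subset_univ _))
    · rintro v (rfl | rfl) h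
      · exact hne i h
      · exact hij (ha h).symm
  have hqq : ∀ i j, i ≠ j → Disjoint (P.supportᶜ ∪ Metric.ball (P.point (a i)) (r i))
      (P.supportOn (insert (a j) Q)) := by
    intro i j hij
    refine Set.disjoint_union_left.2 ⟨?_, (hB i).mono_right (P.supportOn_mono ?_)⟩
    · rw [← P.supportOn_univ]
      exact disjoint_compl_left.mono_right (P.supportOn_mono (Set.subset_univ _))
    · rintro v (rfl | hv) h
      · exact hij (ha h).symm
      · exact haQ i (h ▸ hv)
  have hpq : ∀ i j, i ≠ j → Disjoint (P.supportOn {p, a i})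
      (P.supportOn (insert (a j) Q)) := by
    intro i j hij
    refine P.disjoint_supportOn (Set.disjoint_left.2 ?_)
    rintro v (rfl | rfl) (h | h)
    · exact hne j h
    · exact hpQ h
    · exact hij (ha h)
    · exact haQ i h
  refine not_exists_drawing_K33
    ![fun i => P.supportOn {p, a i}, fun i => P.supportOn (insert (a i) Q),
      fun i => P.supportᶜ ∪ Metric.ball (P.point (a i)) (r i)]
    ![P.point p, P.point q, z 0] (fun i => P.point (a i)) ?_ ?_
  · intro l i
    fin_cases l
    · exact P.joinedIn_of_adj (hpa i) (by simp) (by simp)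
    · obtain ⟨w, hw⟩ := hw i
      exact P.joinedIn_of_walk w hw
    · exact hU i
  · intro l l' i j hl hij
    fin_cases l <;> fin_cases l'
    · exact absurd rfl hl
    · exact hpq i j hij
    · exact (hpp j i hij.symm).symm
    · exact (hpq j i hij.symm).symm
    · exact absurd rfl hl
    · exact (hqq j i hij.symm).symm
    · exact hpp i j hij
    · exact hqq i j hij
    · exact absurd rfl hl

/-! ### Cycles as periodic sequences -/

/-- `f` runs periodically through the `n` distinct vertices of a cycle of `H`. -/
structure IsCyclicSeq {V : Type*} (H : SimpleGraph V) (n : ℕ) (f : ℕ → V) : Prop where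
  three_le : 3 ≤ n
  periodic : Function.Periodic f n
  injOn : ∀ i < n, ∀ j < n, f i = f j → i = j
  adj : ∀ i, H.Adj (f i) (f (i + 1))

namespace IsCyclicSeq

variable {V : Type*} {H : SimpleGraph V} {n : ℕ} {f : ℕ → V}

theorem eq_iff (h : IsCyclicSeq H n f) {i j : ℕ} : f i = f j ↔ i % n = j % n := by
  have hn : 0 < n := by have := h.three_le; omega
  constructor
  · intro e
    rw [← h.periodic.map_mod_nat i, ← h.periodic.map_mod_nat j] at e
    exact h.injOn _ (Nat.mod_lt _ hn) _ (Nat.mod_lt _ hn) e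
  · intro e
    rw [← h.periodic.map_mod_nat i, ← h.periodic.map_mod_nat j, e]

theorem exists_lt (h : IsCyclicSeq H n f) (i : ℕ) : ∃ j < n, f j = f i :=
  ⟨i % n, Nat.mod_lt _ (by have := h.three_le; omega), h.periodic.map_mod_nat i⟩

theorem shift (h : IsCyclicSeq H n f) (k : ℕ) : IsCyclicSeq H n (fun i => f (i + k)) where
  three_le := h.three_le
  periodic i := by
    change f (i + n + k) = f (i + k)
    rw [add_right_comm, h.periodic]
  injOn i hi j hj e := by
    have e' : i ≡ j [MOD n] := Nat.ModEq.add_right_cancel' k (h.eq_iff.1 e)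
    exact Nat.ModEq.eq_of_lt_of_lt e' hi hj
  adj i := by
    have := h.adj (i + k)
    rwa [add_right_comm] at this

theorem exists_shift_eq (h : IsCyclicSeq H n f) (k i : ℕ) : ∃ j, f (j + k) = f i := by
  refine ⟨i + k * (n - 1), ?_⟩
  have hn := h.three_le
  rw [h.eq_iff]
  have : i + k * (n - 1) + k = i + k * n := by
    obtain ⟨m, rfl⟩ : ∃ m, n = m + 1 := ⟨n - 1, by omega⟩
    simp only [Nat.add_sub_cancel]
    ring
  rw [this, Nat.add_mul_mod_self_right]

theorem of_closed {g : ℕ → V} (hn : 3 ≤ n) (hinj : ∀ i < n, ∀ j < n, g i = g j → i = j)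
    (hadj : ∀ i, i + 1 < n → H.Adj (g i) (g (i + 1))) (hlast : H.Adj (g (n - 1)) (g 0)) :
    IsCyclicSeq H n (fun i => g (i % n)) where
  three_le := hn
  periodic i := by simp
  injOn i hi j hj e := by
    rw [Nat.mod_eq_of_lt hi, Nat.mod_eq_of_lt hj] at e
    exact hinj i hi j hj e
  adj i := by
    have hlt : i % n < n := Nat.mod_lt _ (by omega)
    rcases Nat.lt_or_ge (i % n + 1) n with h | h
    · have : (i + 1) % n = i % n + 1 := by
        rw [Nat.add_mod, Nat.mod_eq_of_lt (by omega : 1 < n), Nat.mod_eq_of_lt h]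
      rw [this]
      exact hadj _ h
    · have h1 : i % n = n - 1 := by omega
      have : (i + 1) % n = 0 := by
        rw [Nat.add_mod, Nat.mod_eq_of_lt (by omega : 1 < n), h1, Nat.sub_add_cancel (by omega),
          Nat.mod_self]
      rw [this, h1]
      exact hlast

/-- A path with adjacent ends closes up to a cycle. -/
theorem of_isPath {u v : V} {p : H.Walk u v} (hp : p.IsPath) (h2 : 2 ≤ p.length)
    (h : H.Adj v u) : IsCyclicSeq H (p.length + 1) (fun i => p.getVert (i % (p.length + 1))) := by
  refine of_closed (by omega) (fun i hi j hj e => ?_) (fun i hi => ?_) ?_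
  · exact hp.getVert_injOn (by simp; omega) (by simp; omega) e
  · exact p.adj_getVert_succ (by omega)
  · simpa using h

/-- Replacing the edge of a cycle by a path whose inner vertices are new gives a longer cycle. -/
theorem splice (h : IsCyclicSeq H n f) {a b : V} {p : H.Walk a b} (hp : p.IsPath)
    (hd : ∀ i, f i ∉ p.support) (ha : H.Adj (f (n - 1)) a) (hb : H.Adj b (f 0)) :
    ∃ g, IsCyclicSeq H (n + p.length + 1) g := by
  have hn := h.three_le
  have hd' : ∀ i j, f i ≠ p.getVert j := fun i j e => hd i (e ▸ p.getVert_mem_support j)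
  refine ⟨_, of_closed (g := fun i => if i < n then f i else p.getVert (i - n)) (by omega)
    (fun i hi j hj e => ?_) (fun i hi => ?_) ?_⟩
  · split_ifs at e with h1 h2 h2
    · exact h.injOn i h1 j h2 e
    · exact absurd e (hd' _ _)
    · exact absurd e.symm (hd' _ _)
    · have := hp.getVert_injOn (by simp; omega) (by simp; omega) e
      omega
  · split_ifs with h1 h2 h2
    · exact h.adj i
    · obtain rfl : i = n - 1 := by omega
      rw [show n - 1 + 1 - n = 0 by omega, p.getVert_zero]
      exact ha
    · omega
    · rw [show i + 1 - n = (i - n) + 1 by omega]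
      exact p.adj_getVert_succ (by omega)
  · rw [if_neg (by omega), if_pos (by omega), show n + p.length + 1 - 1 - n = p.length by omega,
      p.getVert_length]
    exact hb

theorem le_card [Fintype V] (h : IsCyclicSeq H n f) : n ≤ Fintype.card V := by
  have := Fintype.card_le_of_injective (fun i : Fin n => f i)
    (fun i j e => Fin.ext (h.injOn i i.2 j j.2 e))
  simpa using this

theorem exists_walk (h : IsCyclicSeq H n f) {i j : ℕ} (hij : i ≤ j) :
    ∃ w : H.Walk (f i) (f j), ∀ u ∈ w.support, ∃ k, i ≤ k ∧ k ≤ j ∧ u = f k := by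
  induction j, hij using Nat.le_induction with
  | base => exact ⟨.nil, fun u hu => ⟨i, le_rfl, le_rfl, by simpa using hu⟩⟩
  | succ j hij ih =>
    obtain ⟨w, hw⟩ := ih
    refine ⟨w.concat (h.adj j), fun u hu => ?_⟩
    rw [SimpleGraph.Walk.support_concat, List.mem_append, List.mem_singleton] at hu
    rcases hu with hu | rfl
    · obtain ⟨k, h1, h2, h3⟩ := hw u hu
      exact ⟨k, h1, by omega, h3⟩
    · exact ⟨j + 1, by omega, le_rfl, rfl⟩

/-- A cycle in a bipartite graph meets both sides equally often. -/
theorem card_inter_eq [DecidableEq V] (h : IsCyclicSeq H n f) {I X : Finset V}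
    (hIX : ∀ u v, H.Adj u v → (u ∈ X ↔ v ∈ I)) :
    (I ∩ (Finset.range n).image f).card = (X ∩ (Finset.range n).image f).card := by
  have hinj : Set.InjOn f (Finset.range n) := fun i hi j hj e =>
    h.injOn i (by simpa using hi) j (by simpa using hj) e
  have key : ∀ S : Finset V, (S ∩ (Finset.range n).image f).card =
      ∑ i ∈ Finset.range n, if f i ∈ S then 1 else 0 := by
    intro S
    rw [← Finset.card_filter, ← Finset.card_image_of_injOn (hinj.mono (Finset.filter_subset _ _))]
    congr 1
    ext v
    simp only [Finset.mem_inter, Finset.mem_image, Finset.mem_filter]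
    constructor
    · rintro ⟨hv, i, hi, rfl⟩
      exact ⟨i, ⟨hi, hv⟩, rfl⟩
    · rintro ⟨i, ⟨hi, hv⟩, rfl⟩
      exact ⟨hv, i, hi, rfl⟩
  rw [key, key]
  -- the indicator of `I` at `i + 1` is that of `X` at `i`, and a shift keeps the sum over a period
  have h1 := Finset.sum_range_succ (fun i => if f i ∈ I then 1 else 0) n
  have h2 := Finset.sum_range_succ' (fun i => if f i ∈ I then 1 else 0) n
  have h0 : f n = f 0 := by simpa using h.periodic 0
  simp only [h0] at h1
  simp only [← hIX _ _ (h.adj _)] at h2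
  omega

end IsCyclicSeq

/-! ### Splitting a deficient bipartite graph -/

/-- `H` with all edges at vertices of `C` removed. -/
def SimpleGraph.avoid {V : Type*} (H : SimpleGraph V) (C : Set V) : SimpleGraph V where
  Adj u v := H.Adj u v ∧ u ∉ C ∧ v ∉ C
  symm := ⟨fun _ _ h => ⟨h.1.symm, h.2.2, h.2.1⟩⟩
  loopless := ⟨fun _ h => h.1.ne rfl⟩

theorem SimpleGraph.Reachable.exists_path_of_avoid {V : Type*} {H : SimpleGraph V} {C : Set V}
    {u v : V} (h : (H.avoid C).Reachable u v) (hu : u ∉ C) :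
    ∃ p : H.Walk u v, p.IsPath ∧ ∀ w ∈ p.support, w ∉ C ∧ (H.avoid C).Reachable u w := by
  obtain ⟨p, hp⟩ := h.exists_isPath
  have hle : H.avoid C ≤ H := fun _ _ h => h.1
  refine ⟨p.mapLe hle, hp.mapLe hle, fun w hw => ?_⟩
  rw [SimpleGraph.Walk.support_mapLe_eq_support] at hw
  have hr : (H.avoid C).Reachable u w := by
    classical
    exact ⟨p.takeUntil w hw⟩
  refine ⟨?_, hr⟩
  obtain ⟨q⟩ := hr
  cases q using SimpleGraph.Walk.concatRec with
  | Hnil => exact hu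
  | Hconcat q h _ => exact h.2.2

/-- If `A` has more vertices than `B`, the same holds inside some connected component. -/
theorem exists_surplus_component {V : Type*} [DecidableEq V] {H : SimpleGraph V} {A B : Finset V}
    (h : B.card < A.card) :
    ∃ k ∈ A, ∀ T : Finset V, (∀ v, v ∈ T ↔ H.Reachable k v) →
      (B ∩ T).card < (A ∩ T).card := by
  classical
  by_contra! hc
  let t := (A ∪ B).image H.connectedComponentMk
  have hA : ∀ v ∈ A, H.connectedComponentMk v ∈ t := fun v hv =>
    Finset.mem_image_of_mem _ (Finset.mem_union_left _ hv)
  have hB : ∀ v ∈ B, H.connectedComponentMk v ∈ t := fun v hv =>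
    Finset.mem_image_of_mem _ (Finset.mem_union_right _ hv)
  rw [Finset.card_eq_sum_card_fiberwise hA, Finset.card_eq_sum_card_fiberwise hB] at h
  refine absurd h (not_lt.2 (Finset.sum_le_sum fun K _ => ?_))
  by_cases hK : ∃ k ∈ A, H.connectedComponentMk k = K
  · obtain ⟨k, hk, rfl⟩ := hK
    obtain ⟨T, hT, h'⟩ := hc k hk
    convert h' using 2
    · ext v
      simp [hT, eq_comm, SimpleGraph.ConnectedComponent.eq]
    · ext v
      simp [hT, eq_comm, SimpleGraph.ConnectedComponent.eq]
  · push Not at hK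
    rw [Finset.filter_false_of_mem hK]
    simp

/-- Two vertices `f 0` and `f j` of a longest cycle are not joined by a path with inner vertices
outside of it: if they are consecutive on the cycle, a longer cycle results, and otherwise a theta
graph, whose three vertices of degree two next to `f 0` are `f 1`, `f (n - 1)` and `k`. -/
theorem IsCyclicSeq.false_of_ear {V : Type*} {H : SimpleGraph V} (hH : NoThetaAt H) {n : ℕ}
    {f : ℕ → V} (h : IsCyclicSeq H n f) (hmax : ∀ m g, IsCyclicSeq H m g → m ≤ n) {k y : V}
    {j : ℕ} (hj0 : j ≠ 0) (hjn : j < n) {p : H.Walk y k} (hp : p.IsPath)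
    (hd : ∀ i, f i ∉ p.support) (hk : H.Adj k (f 0)) (hy : H.Adj (f j) y) : False := by
  have hn := h.three_le
  have hfn : f n = f 0 := by simpa using h.periodic 0
  rcases eq_or_ne j (n - 1) with rfl | hjn'
  · obtain ⟨g, hg⟩ := h.splice hp hd hy hk
    have := hmax _ _ hg
    omega
  rcases eq_or_ne j 1 with rfl | hj1
  · obtain ⟨g, hg⟩ := (h.shift 1).splice hp.reverse
      (fun i => by rw [SimpleGraph.Walk.support_reverse, List.mem_reverse]; exact hd _)
      (by rw [Nat.sub_add_cancel (by omega), hfn]; exact hk.symm) (by simpa using hy.symm)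
    have := hmax _ _ hg
    rw [SimpleGraph.Walk.length_reverse] at this
    omega
  have hkp : k ∈ p.support := p.end_mem_support
  have hne : ∀ i, f i ≠ k := fun i e => hd i (e ▸ hkp)
  have hin : ∀ i < n, ∀ j < n, f i = f j → i = j := h.injOn
  refine hH (f 0) (f j) ![f 1, f (n - 1), k]
    ({v | ∃ i, 2 ≤ i ∧ i ≤ n - 2 ∧ v = f i} ∪ {v | v ∈ p.support ∧ v ≠ k}) ?_ ?_ ?_ ?_ ?_ ?_
  · have h1 : f 1 ≠ f (n - 1) := fun e => by
      have := hin 1 (by omega) (n - 1) (by omega) e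
      omega
    intro a b e
    fin_cases a <;> fin_cases b <;> first | rfl | exfalso
    · exact h1 e
    · exact hne _ e
    · exact h1 e.symm
    · exact hne _ e
    · exact hne _ e.symm
    · exact hne _ e.symm
  · rintro (⟨i, h1, h2, e⟩ | ⟨e, -⟩)
    · have := hin 0 (by omega) i (by omega) e
      omega
    · exact hd _ e
  · exact Or.inl ⟨j, by omega, by omega, rfl⟩
  · intro i
    fin_cases i
    · exact h.adj 0
    · have := h.adj (n - 1)
      rw [Nat.sub_add_cancel (by omega), hfn] at this
      exact this.symm
    · exact hk.symm
  · intro i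
    fin_cases i
    · rintro (⟨i, h1, h2, e⟩ | ⟨e, -⟩)
      · have := hin 1 (by omega) i (by omega) e
        omega
      · exact hd _ e
    · rintro (⟨i, h1, h2, e⟩ | ⟨e, -⟩)
      · have := hin (n - 1) (by omega) i (by omega) e
        omega
      · exact hd _ e
    · rintro (⟨i, h1, h2, e⟩ | ⟨-, e⟩)
      · exact hne _ e.symm
      · exact e rfl
  · intro i
    fin_cases i
    · obtain ⟨w, hw⟩ := h.exists_walk (show 1 ≤ j by omega)
      refine ⟨w.reverse, fun u hu => ?_⟩
      change u ∈ (w.reverse : H.Walk (f j) (f 1)).support at hu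
      rw [SimpleGraph.Walk.support_reverse, List.mem_reverse] at hu
      obtain ⟨i, h1, h2, rfl⟩ := hw u hu
      rcases eq_or_ne i 1 with rfl | hi
      · exact Or.inl rfl
      · exact Or.inr (Or.inl ⟨i, by omega, by omega, rfl⟩)
    · obtain ⟨w, hw⟩ := h.exists_walk (show j ≤ n - 1 by omega)
      refine ⟨w, fun u hu => ?_⟩
      obtain ⟨i, h1, h2, rfl⟩ := hw u hu
      rcases eq_or_ne i (n - 1) with rfl | hi
      · exact Or.inl rfl
      · exact Or.inr (Or.inl ⟨i, by omega, by omega, rfl⟩)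
    · refine ⟨.cons hy p, fun u hu => ?_⟩
      rcases List.mem_cons.1 hu with rfl | hu
      · exact Or.inr (Or.inl ⟨j, by omega, by omega, rfl⟩)
      · rcases eq_or_ne u k with rfl | hu'
        · exact Or.inl rfl
        · exact Or.inr (Or.inr ⟨hu, hu'⟩)

/-- In a graph with parts `I` and `X` in which `I` is minimal with more vertices than neighbours,
no vertex `c ∈ X` that does not split `I` into two deficient parts separates vertices of `I`. For a
union of components of the graph without `c` and its complement, the differences `|I₁| - |X₁|` and
`|I₂| - |X₂|` add up to at least two; if one of them is not positive, the other is at least two, so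
that its part remains deficient with `c` added, and by minimality contains all of `I`. -/
theorem reachable_avoid_of_minimal {V : Type*} [DecidableEq V] {H : SimpleGraph V}
    {I X : Finset V} (hdisj : Disjoint I X)
    (hIX : ∀ u v, H.Adj u v → (u ∈ I ∧ v ∈ X) ∨ (u ∈ X ∧ v ∈ I)) (hcard : X.card < I.card)
    (hmin : ∀ I' ⊂ I, ∀ X' ⊆ X, (∀ v ∈ I', ∀ u, H.Adj v u → u ∈ X') → I'.card ≤ X'.card)
    {c : V} (hc : c ∈ X)
    (hsplit : ∀ I₁ ⊆ I, ∀ I₂ ⊆ I, ∀ X₁ ⊆ X.erase c, ∀ X₂ ⊆ X.erase c, Disjoint I₁ I₂ →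
      Disjoint X₁ X₂ → (∀ v ∈ I₁, ∀ u, H.Adj v u → u ∈ insert c X₁) →
      (∀ v ∈ I₂, ∀ u, H.Adj v u → u ∈ insert c X₂) → X₁.card < I₁.card → I₂.card ≤ X₂.card)
    {i j : V} (hi : i ∈ I) (hj : j ∈ I) : (H.avoid {c}).Reachable i j := by
  classical
  let K : V → Prop := fun v => (H.avoid {c}).Reachable i v
  have hstep : ∀ v ∈ I, ∀ u, H.Adj v u → u ≠ c → (K v ↔ K u) := by
    intro v hv u hvu huc
    have hvc : v ≠ c := by
      rintro rfl
      exact Finset.disjoint_left.1 hdisj hv hc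
    have hadj : (H.avoid {c}).Adj v u := ⟨hvu, hvc, huc⟩
    exact ⟨fun h => h.trans hadj.reachable, fun h => h.trans hadj.symm.reachable⟩
  have hnb : ∀ v ∈ I, ∀ u, H.Adj v u → u ∈ X := by
    intro v hv u hvu
    rcases hIX _ _ hvu with h | h
    · exact h.2
    · exact absurd h.1 (Finset.disjoint_left.1 hdisj hv)
  have h1 : ∀ v ∈ I.filter K, ∀ u, H.Adj v u → u ∈ insert c ((X.erase c).filter K) := by
    intro v hv u hvu
    rw [Finset.mem_filter] at hv
    by_cases huc : u = c
    · simp [huc]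
    · simp [huc, hnb v hv.1 u hvu, (hstep v hv.1 u hvu huc).1 hv.2]
  have h2 : ∀ v ∈ I.filter (¬ K ·), ∀ u, H.Adj v u →
      u ∈ insert c ((X.erase c).filter (¬ K ·)) := by
    intro v hv u hvu
    rw [Finset.mem_filter] at hv
    by_cases huc : u = c
    · simp [huc]
    · have := (hstep v hv.1 u hvu huc).not.1 hv.2
      simp [huc, hnb v hv.1 u hvu, this]
  have cI := Finset.card_filter_add_card_filter_not (s := I) K
  have cX := Finset.card_filter_add_card_filter_not (s := X.erase c) K
  have cc := Finset.card_erase_add_one hc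
  have hins : ∀ (p : V → Prop) [DecidablePred p], insert c ((X.erase c).filter p) ⊆ X := by
    intro p _
    exact Finset.insert_subset hc ((Finset.filter_subset _ _).trans (Finset.erase_subset _ _))
  have hci : ∀ (p : V → Prop) [DecidablePred p], (insert c ((X.erase c).filter p)).card ≤
      ((X.erase c).filter p).card + 1 := fun p _ => Finset.card_insert_le _ _
  have hs := hsplit _ (Finset.filter_subset K I) _ (Finset.filter_subset (¬ K ·) I)
    _ (Finset.filter_subset K _) _ (Finset.filter_subset (¬ K ·) _)
    (Finset.disjoint_filter_filter_not _ _ _) (Finset.disjoint_filter_filter_not _ _ _) h1 h2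
  have hiK : i ∈ I.filter K := Finset.mem_filter.2 ⟨hi, SimpleGraph.Reachable.refl _⟩
  by_contra hjK
  rcases Nat.lt_or_ge ((X.erase c).filter K).card (I.filter K).card with hlt | hle
  · have := hmin (I.filter K) (Finset.filter_ssubset.2 ⟨j, hj, hjK⟩) _ (hins K) h1
    have := hs hlt
    have := hci K
    omega
  · have := hmin (I.filter (¬ K ·)) (Finset.filter_ssubset.2 ⟨i, hi, fun h => h (.refl _)⟩) _
      (hins (¬ K ·)) h2
    have := hci (¬ K ·)
    omega

/-- A bipartite graph without theta graphs whose part `I` is larger than the other part `X`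
has a smaller deficient subgraph of the same kind, or a vertex `c ∈ X` whose removal
leaves two disjoint ones. -/
theorem exists_deficient_split {V : Type*} [Fintype V] [DecidableEq V] {H : SimpleGraph V}
    (hH : NoThetaAt H) {I X : Finset V} (hdisj : Disjoint I X)
    (hIX : ∀ u v, H.Adj u v → (u ∈ I ∧ v ∈ X) ∨ (u ∈ X ∧ v ∈ I)) (hcard : X.card < I.card)
    (hX : X.Nonempty) :
    (∃ I' ⊂ I, ∃ X' ⊆ X, (∀ v ∈ I', ∀ u, H.Adj v u → u ∈ X') ∧ X'.card < I'.card) ∨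
    ∃ c ∈ X, ∃ I₁ ⊆ I, ∃ I₂ ⊆ I, ∃ X₁ ⊆ X.erase c, ∃ X₂ ⊆ X.erase c, Disjoint I₁ I₂ ∧
      Disjoint X₁ X₂ ∧ (∀ v ∈ I₁, ∀ u, H.Adj v u → u ∈ insert c X₁) ∧
      (∀ v ∈ I₂, ∀ u, H.Adj v u → u ∈ insert c X₂) ∧ X₁.card < I₁.card ∧
      X₂.card < I₂.card := by
  classical
  by_contra! hcon
  obtain ⟨hmin, hsplit⟩ := hcon
  have hreach : ∀ c ∈ X, ∀ i ∈ I, ∀ j ∈ I, (H.avoid {c}).Reachable i j :=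
    fun c hc i hi j hj => reachable_avoid_of_minimal hdisj hIX hcard hmin hc (hsplit c hc) hi hj
  have hnbI : ∀ v ∈ I, ∀ u, H.Adj v u → u ∈ X := by
    intro v hv u hvu
    rcases hIX _ _ hvu with h | h
    · exact h.2
    · exact absurd h.1 (Finset.disjoint_left.1 hdisj hv)
  have hnbX : ∀ v ∈ X, ∀ u, H.Adj v u → u ∈ I := by
    intro v hv u hvu
    rcases hIX _ _ hvu with h | h
    · exact absurd hv (Finset.disjoint_left.1 hdisj h.1)
    · exact h.2
  -- a vertex of `X` has two neighbours by minimality, and these are joined by a path that avoids it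
  have hcyc : ∃ n f, IsCyclicSeq H n f := by
    obtain ⟨x, hx⟩ := hX
    have h1 : 1 < (I.filter (H.Adj x ·)).card := by
      by_contra! h1
      obtain ⟨R, hR1, hR2, hR3⟩ := Finset.exists_subsuperset_card_eq
        (Finset.filter_subset (H.Adj x ·) I) h1 (by omega)
      have hI' : I \ R ⊂ I := Finset.sdiff_ssubset hR2 (Finset.card_pos.1 (by omega))
      have := hmin (I \ R) hI' (X.erase x) (Finset.erase_subset _ _) (fun v hv u hvu => by
        rw [Finset.mem_sdiff] at hv
        refine Finset.mem_erase.2 ⟨?_, hnbI v hv.1 u hvu⟩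
        rintro rfl
        exact hv.2 (hR1 (Finset.mem_filter.2 ⟨hv.1, hvu.symm⟩)))
      rw [Finset.card_sdiff_of_subset hR2, Finset.card_erase_of_mem hx] at this
      have := Finset.card_pos.2 ⟨x, hx⟩
      omega
    obtain ⟨i, hi, j, hj, hij⟩ := Finset.one_lt_card.1 h1
    rw [Finset.mem_filter] at hi hj
    obtain ⟨p, hp, hpx⟩ := (hreach x hx i hi.1 j hj.1).exists_path_of_avoid (hi.2.ne')
    have hp' : (SimpleGraph.Walk.cons hi.2 p).IsPath :=
      hp.cons (fun h => (hpx x h).1 rfl)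
    refine ⟨_, _, IsCyclicSeq.of_isPath hp' ?_ hj.2.symm⟩
    have : p.length ≠ 0 := fun h => hij (SimpleGraph.Walk.eq_of_length_eq_zero h)
    rw [SimpleGraph.Walk.length_cons]
    omega
  obtain ⟨n, f, hf, hmax⟩ : ∃ n f, IsCyclicSeq H n f ∧ ∀ m g, IsCyclicSeq H m g → m ≤ n := by
    obtain ⟨n₀, hn₀⟩ := hcyc
    have hex : ∃ n, n ≤ Fintype.card V ∧ ∃ f, IsCyclicSeq H n f :=
      ⟨n₀, hn₀.choose_spec.le_card, hn₀⟩
    obtain ⟨f, hf⟩ := Nat.findGreatest_spec (P := fun n => ∃ f, IsCyclicSeq H n f)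
      hn₀.choose_spec.le_card hn₀
    exact ⟨_, f, hf, fun m g hg => Nat.le_findGreatest hg.le_card ⟨g, hg⟩⟩
  set C : Finset V := (Finset.range n).image f with hC
  have hfC : ∀ i, f i ∈ C := by
    intro i
    obtain ⟨j, hj, h⟩ := hf.exists_lt i
    exact Finset.mem_image.2 ⟨j, Finset.mem_range.2 hj, h⟩
  have hbal : (I ∩ C).card = (X ∩ C).card := hf.card_inter_eq fun u v huv =>
    ⟨fun hu => hnbX u hu v huv, fun hv => hnbI v hv u huv.symm⟩
  have hout : (X \ C).card < (I \ C).card := by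
    have := Finset.card_inter_add_card_sdiff I C
    have := Finset.card_inter_add_card_sdiff X C
    omega
  -- a component of the complement of the cycle that has more vertices in `I` than in `X`
  obtain ⟨i₀, hi₀, hsur⟩ := exists_surplus_component (H := H.avoid C) hout
  rw [Finset.mem_sdiff] at hi₀
  set K : Finset V := Finset.univ.filter fun v => (H.avoid C).Reachable i₀ v with hK
  have memK : ∀ v, v ∈ K ↔ (H.avoid C).Reachable i₀ v := by simp [hK]
  have hKC : ∀ v ∈ K, v ∉ C := by
    intro v hv
    obtain ⟨p, -, hp⟩ := ((memK v).1 hv).exists_path_of_avoid (C := C)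
      (u := i₀) (by simpa using hi₀.2)
    simpa using (hp v p.end_mem_support).1
  have hstep : ∀ v ∈ K, ∀ u, H.Adj v u → u ∉ C → u ∈ K := by
    intro v hv u hvu hu
    have hadj : (H.avoid C).Adj v u := ⟨hvu, by simpa using hKC v hv, by simpa using hu⟩
    exact (memK u).2 (((memK v).1 hv).trans hadj.reachable)
  have hsur' := hsur K memK
  -- by minimality this component is adjacent to a vertex `x ∈ X` of the cycle
  obtain ⟨k, hk, x, hkx, hxX, hxC⟩ : ∃ k ∈ I ∩ K, ∃ x, H.Adj k x ∧ x ∈ X ∧ x ∈ C := by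
    by_contra! hno
    have hIK : (I \ C) ∩ K = I ∩ K := by
      ext v
      simp only [Finset.mem_inter, Finset.mem_sdiff]
      exact ⟨fun h => ⟨h.1.1, h.2⟩, fun h => ⟨⟨h.1, hKC v h.2⟩, h.2⟩⟩
    obtain ⟨i₁, hi₁I, hi₁C⟩ : ∃ i ∈ I, i ∈ C := by
      rcases hIX _ _ (hf.adj 0) with h | h
      · exact ⟨_, h.1, hfC _⟩
      · exact ⟨_, h.2, hfC _⟩
    have hss : I ∩ K ⊂ I := by
      refine Finset.ssubset_iff_subset_ne.2 ⟨Finset.inter_subset_left, fun e => ?_⟩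
      rw [← e] at hi₁I
      exact hKC _ (Finset.mem_inter.1 hi₁I).2 hi₁C
    have := hmin (I ∩ K) hss ((X \ C) ∩ K)
      (Finset.inter_subset_left.trans Finset.sdiff_subset) (fun v hv u hvu => by
        have hv' := Finset.mem_inter.1 hv
        have huX := hnbI v hv'.1 u hvu
        have huC := hno v hv u hvu huX
        exact Finset.mem_inter.2 ⟨Finset.mem_sdiff.2 ⟨huX, huC⟩, hstep v hv'.2 u hvu huC⟩)
    rw [hIK] at hsur'
    omega
  obtain ⟨hkI, hkK⟩ := Finset.mem_inter.1 hk
  obtain ⟨m, -, rfl⟩ := Finset.mem_image.1 hxC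
  set g : ℕ → V := fun i => f (i + m) with hg
  have hgc : IsCyclicSeq H n g := hf.shift m
  have hg0 : g 0 = f m := by simp [hg]
  have hgC : ∀ v ∈ C, ∃ j < n, g j = v := by
    intro v hv
    obtain ⟨i, -, rfl⟩ := Finset.mem_image.1 hv
    obtain ⟨j, hj⟩ := hf.exists_shift_eq m i
    obtain ⟨j', hj', e⟩ := hgc.exists_lt j
    exact ⟨j', hj', e.trans hj⟩
  have hg1 : g 1 ∈ I := hnbX _ hxX _ (hg0 ▸ hgc.adj 0)
  -- as `x` does not separate, a second vertex of the cycle is adjacent to the component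
  obtain ⟨p⟩ := hreach _ hxX k hkI (g 1) hg1
  obtain ⟨d, -, hd1, hd2⟩ := p.exists_boundary_dart K (by simpa using hkK)
    (by simpa using fun h => hKC _ h (hfC _))
  obtain ⟨hadj, -, hdx⟩ := d.adj
  have hdC : d.snd ∈ C := by
    by_contra h
    exact hd2 (hstep _ hd1 _ hadj h)
  obtain ⟨j, hjn, hj⟩ := hgC _ hdC
  have hyk : (H.avoid C).Reachable d.fst k :=
    ((memK _).1 hd1).symm.trans ((memK _).1 hkK)
  obtain ⟨q, hq, hqC⟩ := hyk.exists_path_of_avoid (by simpa using hKC _ hd1)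
  refine hgc.false_of_ear hH hmax (j := j) ?_ hjn hq (fun i hi => (hqC _ hi).1 (hfC _))
    (hg0 ▸ hkx) (hj ▸ hadj.symm)
  rintro rfl
  exact hdx (by rw [← hj, hg0]; rfl)

/-! ### A strategy for Staller -/

section Game

variable {V : Type*} [DecidableEq V] {G : SimpleGraph V}

theorem not_dominatorWins_of_closed_neighborhood {D S : Finset V} {p : Player} {v : V}
    (hv : v ∈ S) (hN : ∀ u, G.Adj v u → u ∈ S) (hDS : Disjoint D S) :
    ¬ DominatorWins G p D S := by
  intro h
  induction h with
  | won p D S h =>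
    obtain ⟨x, hx, h⟩ := h v
    refine Finset.disjoint_left.1 hDS hx ?_
    rcases h with rfl | h
    · exact hv
    · exact hN x h
  | dominator_move D S w hw h ih =>
    rw [Finset.notMem_union] at hw
    exact ih hv hN (Finset.disjoint_insert_left.2 ⟨hw.2, hDS⟩)
  | staller_move D S hne h ih =>
    obtain ⟨w, hw⟩ := hne
    rw [Finset.notMem_union] at hw
    exact ih w (by simp [hw]) (Finset.mem_insert_of_mem hv)
      (fun u hu => Finset.mem_insert_of_mem (hN u hu)) (Finset.disjoint_insert_right.2 ⟨hw.1, hDS⟩)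

/-- An unclaimed set `I` whose neighbours are claimed by Staller or lie in a smaller
unclaimed set `X`. -/
structure IsDeficient (G : SimpleGraph V) (D S I X : Finset V) : Prop where
  disjoint_claimed : Disjoint D S
  disjoint_left : Disjoint I (D ∪ S)
  disjoint_right : Disjoint X (D ∪ S)
  disjoint : Disjoint I X
  neighbors : ∀ v ∈ I, ∀ u, G.Adj v u → u ∈ X ∨ u ∈ S
  card_lt : X.card < I.card

namespace IsDeficient

variable {D S I X : Finset V}

theorem not_isDominatingSet (h : IsDeficient G D S I X) : ¬ IsDominatingSet G D := by
  intro hD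
  obtain ⟨v, hv⟩ : I.Nonempty := Finset.card_pos.1 (by have := h.card_lt; omega)
  obtain ⟨x, hx, rfl | hvx⟩ := hD v
  · exact Finset.disjoint_left.1 h.disjoint_left hv (Finset.mem_union_left _ hx)
  · rcases h.neighbors v hv x hvx with h' | h'
    · exact Finset.disjoint_left.1 h.disjoint_right h' (Finset.mem_union_left _ hx)
    · exact Finset.disjoint_left.1 h.disjoint_claimed hx h'

/-- A deficient part survives one further move of each player that stays outside of it, provided
that Staller claims the neighbours that are given up. -/
theorem claim (h : IsDeficient G D S I X) {c v : V} {I' X' : Finset V} (hI : I' ⊆ I)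
    (hX : X' ⊆ X.erase c) (hc : c ∈ X) (hv : v ∉ D ∪ insert c S)
    (hN : ∀ w ∈ I', ∀ u ∈ X, G.Adj w u → u ∈ insert c X') (hcard : X'.card < I'.card)
    (hvI : v ∉ I') (hvX : v ∉ X') :
    IsDeficient G (insert v D) (insert c S) I' X' := by
  have hl := Finset.disjoint_left.1 h.disjoint_left
  have hr := Finset.disjoint_left.1 h.disjoint_right
  have hd := Finset.disjoint_left.1 h.disjoint
  simp only [Finset.mem_union, Finset.mem_insert, not_or] at hv hl hr
  refine ⟨?_, ?_, ?_, h.disjoint.mono hI (hX.trans (Finset.erase_subset _ _)), ?_, hcard⟩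
  · rw [Finset.disjoint_insert_left, Finset.disjoint_insert_right]
    exact ⟨by simp [hv.2], (hr hc).1, h.disjoint_claimed⟩
  · rw [Finset.disjoint_left]
    intro w hw hw'
    simp only [Finset.mem_union, Finset.mem_insert] at hw'
    rcases hw' with (rfl | hw') | (rfl | hw')
    · exact hvI hw
    · exact (hl (hI hw)).1 hw'
    · exact hd (hI hw) hc
    · exact (hl (hI hw)).2 hw'
  · rw [Finset.disjoint_left]
    intro w hw hw'
    have hwX := Finset.mem_erase.1 (hX hw)
    simp only [Finset.mem_union, Finset.mem_insert] at hw'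
    rcases hw' with (rfl | hw') | (rfl | hw')
    · exact hvX hw
    · exact (hr hwX.2).1 hw'
    · exact hwX.1 rfl
    · exact (hr hwX.2).2 hw'
  · intro w hw u hwu
    rcases h.neighbors w (hI hw) u hwu with hu | hu
    · rcases Finset.mem_insert.1 (hN w hw u hu hwu) with rfl | hu'
      · exact Or.inr (Finset.mem_insert_self _ _)
      · exact Or.inl hu'
    · exact Or.inr (Finset.mem_insert_of_mem hu)

/-- Staller wins by claiming a vertex that splits a minimal deficient part into two deficient
parts, since Dominator's answer disturbs only one of them. -/
theorem not_dominatorWins [Fintype V] (hG : NoThetaAt G) (h : IsDeficient G D S I X) :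
    ¬ DominatorWins G Player.staller D S := by
  induction hn : I.card using Nat.strong_induction_on generalizing D S I X with
  | _ n ih =>
  subst hn
  intro hwin
  have hd := Finset.disjoint_left.1 h.disjoint
  have hmove : ∀ v, v ∉ D ∪ S → DominatorWins G Player.dominator D (insert v S) := by
    cases hwin with
    | won _ _ _ hD => exact absurd hD h.not_isDominatingSet
    | staller_move _ _ _ hmove => exact hmove
  rcases X.eq_empty_or_nonempty with rfl | hX
  · obtain ⟨v, hv⟩ : I.Nonempty := Finset.card_pos.1 (by simpa using h.card_lt)
    have hv' := Finset.disjoint_left.1 h.disjoint_left hv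
    refine not_dominatorWins_of_closed_neighborhood (Finset.mem_insert_self v S)
      (fun u hu => Finset.mem_insert_of_mem ?_) ?_ (hmove v hv')
    · simpa using h.neighbors v hv u hu
    · exact Finset.disjoint_insert_right.2
        ⟨fun h => hv' (Finset.mem_union_left _ h), h.disjoint_claimed⟩
  let H : SimpleGraph V :=
    { Adj := fun u v => G.Adj u v ∧ ((u ∈ I ∧ v ∈ X) ∨ (u ∈ X ∧ v ∈ I))
      symm := ⟨fun u v huv => ⟨huv.1.symm, huv.2.symm.imp And.symm And.symm⟩⟩
      loopless := ⟨fun u hu => hu.1.ne rfl⟩ }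
  have hH : ∀ v ∈ I, ∀ u ∈ X, G.Adj v u → H.Adj v u := fun v hv u hu hvu =>
    ⟨hvu, Or.inl ⟨hv, hu⟩⟩
  rcases exists_deficient_split (H := H) (hG.mono fun _ _ h => h.1) h.disjoint (fun u v h => h.2)
    h.card_lt hX with ⟨I', hI, X', hX', hN, hcard⟩ |
      ⟨c, hc, I₁, hI₁, I₂, hI₂, X₁, hX₁, X₂, hX₂, hdI, hdX, hN₁, hN₂, hcard₁, hcard₂⟩
  · refine ih _ (Finset.card_lt_card hI) (I := I') (X := X') ?_ rfl hwin
    refine ⟨h.disjoint_claimed, h.disjoint_left.mono_left hI.1, h.disjoint_right.mono_left hX',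
      h.disjoint.mono hI.1 hX', fun v hv u hvu => ?_, hcard⟩
    exact (h.neighbors v (hI.1 hv) u hvu).imp_left fun hu => hN v hv u (hH v (hI.1 hv) u hu hvu)
  · have hcD := Finset.disjoint_left.1 h.disjoint_right hc
    have hI₁' : I₁.card < I.card := by
      have h1 := Finset.card_le_card (Finset.union_subset hI₁ hI₂)
      rw [Finset.card_union_of_disjoint hdI] at h1
      omega
    have hI₂' : I₂.card < I.card := by
      have h1 := Finset.card_le_card (Finset.union_subset hI₁ hI₂)
      rw [Finset.card_union_of_disjoint hdI] at h1
      omega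
    cases hmove c hcD with
    | won _ _ _ hD => exact h.not_isDominatingSet hD
    | dominator_move _ _ v hv hv' =>
      by_cases hv₁ : v ∈ I₁ ∨ v ∈ X₁
      · refine ih _ hI₂' (h.claim hI₂ hX₂ hc hv (fun w hw u hu hwu =>
          hN₂ w hw u (hH w (hI₂ hw) u hu hwu)) hcard₂ ?_ ?_) rfl hv'
        · rcases hv₁ with hv₁ | hv₁
          · exact Finset.disjoint_left.1 hdI hv₁
          · exact fun hv₂ => hd (hI₂ hv₂) (Finset.mem_of_mem_erase (hX₁ hv₁))
        · rcases hv₁ with hv₁ | hv₁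
          · exact fun hv₂ => hd (hI₁ hv₁) (Finset.mem_of_mem_erase (hX₂ hv₂))
          · exact Finset.disjoint_left.1 hdX hv₁
      · rw [not_or] at hv₁
        exact ih _ hI₁' (h.claim hI₁ hX₁ hc hv (fun w hw u hu hwu =>
          hN₁ w hw u (hH w (hI₁ hw) u hu hwu)) hcard₁ hv₁.1 hv₁.2) rfl hv'

end IsDeficient

/-- If Dominator wins as second player, Hall's condition holds for the neighbourhoods: a set `A`
with fewer than `|A|` neighbours contains the independent set of its vertices without
neighbours in `A`, whose neighbourhood is smaller as well. -/
theorem exists_injective_of_dominatorWins [Fintype V] (hG : NoThetaAt G)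
    (h : DominatorWins G Player.staller ∅ ∅) :
    ∃ s : V → V, Function.Injective s ∧ ∀ v, G.Adj v (s v) := by
  classical
  refine (Fintype.all_card_le_filter_rel_iff_exists_injective G.Adj).1 fun A => ?_
  by_contra! hA
  set N : Finset V := {b | ∃ a ∈ A, G.Adj a b} with hN
  have memN : ∀ b, b ∈ N ↔ ∃ a ∈ A, G.Adj a b := by simp [hN]
  refine IsDeficient.not_dominatorWins (I := A \ N) (X := N \ A) hG ⟨by simp, by simp, by simp,
    ?_, ?_, ?_⟩ h
  · exact Finset.disjoint_left.2 fun v h1 h2 => (Finset.mem_sdiff.1 h2).2 (Finset.mem_sdiff.1 h1).1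
  · intro v hv u hvu
    rw [Finset.mem_sdiff] at hv
    exact Or.inl (Finset.mem_sdiff.2 ⟨(memN u).2 ⟨v, hv.1, hvu⟩,
      fun hu => hv.2 ((memN v).2 ⟨u, hu, hvu.symm⟩)⟩)
  · have h1 := Finset.card_inter_add_card_sdiff A N
    have h2 := Finset.card_inter_add_card_sdiff N A
    rw [Finset.inter_comm] at h2
    omega

/-! ### A strategy for Dominator -/

/-- `v` is neither in `D` nor adjacent to a vertex of `D`. -/
def Undominated (G : SimpleGraph V) (D : Finset V) (v : V) : Prop :=
  ∀ x ∈ D, ¬ (x = v ∨ G.Adj v x)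

theorem undominated_insert {D : Finset V} {z v : V} :
    Undominated G (insert z D) v ↔ z ≠ v ∧ ¬ G.Adj v z ∧ Undominated G D v := by
  simp [Undominated, not_or, and_assoc]

/-- Undominated vertices are unclaimed, and `s` assigns distinct unclaimed neighbours to them. -/
structure IsReservation (G : SimpleGraph V) (D S : Finset V) (s : V → V) : Prop where
  unclaimed : ∀ v, Undominated G D v → v ∉ D ∪ S
  unclaimed_apply : ∀ v, Undominated G D v → s v ∉ D ∪ S
  adj : ∀ v, Undominated G D v → G.Adj v (s v)
  injOn : ∀ v w, Undominated G D v → Undominated G D w → s v = s w → v = w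

namespace IsReservation

variable {D S : Finset V} {s : V → V}

theorem dominator_move (h : IsReservation G D S s) (z : V) :
    IsReservation G (insert z D) S s where
  unclaimed v hv := by
    rw [undominated_insert] at hv
    simpa [hv.1.symm] using h.unclaimed v hv.2.2
  unclaimed_apply v hv := by
    rw [undominated_insert] at hv
    have h1 : s v ≠ z := fun e => hv.2.1 (e ▸ h.adj v hv.2.2)
    simpa [h1] using h.unclaimed_apply v hv.2.2
  adj v hv := h.adj v (undominated_insert.1 hv).2.2
  injOn v w hv hw := h.injOn v w (undominated_insert.1 hv).2.2 (undominated_insert.1 hw).2.2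

theorem staller_move (h : IsReservation G D S s) {v : V}
    (hv : ∀ w, Undominated G D w → w ≠ v ∧ s w ≠ v) : IsReservation G D (insert v S) s where
  unclaimed w hw := by simpa [(hv w hw).1] using h.unclaimed w hw
  unclaimed_apply w hw := by simpa [(hv w hw).2] using h.unclaimed_apply w hw
  adj := h.adj
  injOn := h.injOn

/-- Dominator's answer to Staller's move `v`: she claims the vertex for which `v` was reserved, or
else the neighbour reserved for `v`, or else any undominated vertex. Then `v` and the vertex
for which `v` was reserved are dominated, and so is the vertex for which the claimed vertex was
reserved, because it is adjacent to it. -/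
theorem exists_answer (h : IsReservation G D S s) (hD : ¬ IsDominatingSet G D) (v : V) :
    ∃ z, z ∉ D ∪ insert v S ∧ IsReservation G (insert z D) (insert v S) s := by
  by_cases h1 : ∃ u, Undominated G D u ∧ s u = v
  · obtain ⟨u, hu, rfl⟩ := h1
    have hne := (h.adj u hu).ne
    refine ⟨u, by simpa [hne] using h.unclaimed u hu, (h.dominator_move u).staller_move ?_⟩
    intro w hw
    rw [undominated_insert] at hw
    refine ⟨?_, fun e => hw.1 (h.injOn w u hw.2.2 hu e).symm⟩
    rintro rfl
    exact hw.2.1 (h.adj u hu).symm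
  push Not at h1
  by_cases h2 : Undominated G D v
  · have hadj := h.adj v h2
    refine ⟨s v, by simpa [hadj.ne'] using h.unclaimed_apply v h2,
      (h.dominator_move (s v)).staller_move ?_⟩
    intro w hw
    rw [undominated_insert] at hw
    refine ⟨?_, h1 w hw.2.2⟩
    rintro rfl
    exact hw.2.1 hadj
  · obtain ⟨u, hu⟩ : ∃ u, Undominated G D u := by
      simpa [IsDominatingSet, Undominated, not_or] using hD
    have hne : u ≠ v := by
      rintro rfl
      exact h2 hu
    refine ⟨u, by simpa [hne] using h.unclaimed u hu, (h.dominator_move u).staller_move ?_⟩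
    intro w hw
    rw [undominated_insert] at hw
    refine ⟨?_, h1 w hw.2.2⟩
    rintro rfl
    exact h2 hw.2.2

theorem dominatorWins [Fintype V] (h : IsReservation G D S s) :
    DominatorWins G Player.staller D S := by
  induction hn : (D ∪ S)ᶜ.card using Nat.strong_induction_on generalizing D S with
  | _ n ih =>
  by_cases hD : IsDominatingSet G D
  · exact .won _ _ _ hD
  obtain ⟨u, hu⟩ : ∃ u, Undominated G D u := by
    simpa [IsDominatingSet, Undominated, not_or] using hD
  refine .staller_move _ _ ⟨u, h.unclaimed u hu⟩ fun v hv => ?_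
  obtain ⟨z, hz, hz'⟩ := h.exists_answer hD v
  refine .dominator_move _ _ z hz (ih _ ?_ hz' rfl)
  rw [← hn]
  refine Finset.card_lt_card (Finset.compl_ssubset_compl.2 ?_)
  refine Finset.ssubset_iff_subset_ne.2 ⟨Finset.union_subset_union (Finset.subset_insert _ _)
    (Finset.subset_insert _ _), fun e => hv ?_⟩
  rw [e]
  exact Finset.mem_union_right _ (Finset.mem_insert_self _ _)

end IsReservation

/-- Dominator wins, whoever starts, when all vertices have distinct reserved neighbours. -/
theorem dominatorWins_of_injective [Fintype V] {s : V → V} (hs : Function.Injective s)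
    (hadj : ∀ v, G.Adj v (s v)) (p : Player) : DominatorWins G p ∅ ∅ := by
  have h : IsReservation G ∅ ∅ s :=
    ⟨by simp, by simp, fun v _ => hadj v, fun v w _ _ e => hs e⟩
  cases p with
  | staller => exact h.dominatorWins
  | dominator =>
    rcases isEmpty_or_nonempty V with hV | ⟨⟨v⟩⟩
    · exact .won _ _ _ fun v => hV.elim v
    · exact .dominator_move _ _ v (by simp) (h.dominator_move v).dominatorWins

end Game

/-! ### Perfect factors and injective choices of neighbours -/

theorem isEdgeOrCycle_iff {W : Type*} {K : SimpleGraph W} :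
    IsEdgeOrCycle K ↔ ∃ m : ℕ, Nonempty (K ≃g SimpleGraph.cycleGraph (m + 2)) := by
  rw [IsEdgeOrCycle, ← SimpleGraph.cycleGraph_two_eq_top]
  constructor
  · rintro (h | ⟨n, hn, h⟩)
    · exact ⟨0, h⟩
    · obtain ⟨m, rfl⟩ := Nat.exists_eq_add_of_le' (show 2 ≤ n by omega)
      exact ⟨m, h⟩
  · rintro ⟨_ | m, h⟩
    · exact Or.inl h
    · exact Or.inr ⟨m + 1 + 2, by omega, h⟩

theorem IsEdgeOrCycle.exists_injective {W : Type*} {K : SimpleGraph W} (h : IsEdgeOrCycle K) :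
    ∃ s : W → W, Function.Injective s ∧ ∀ v, K.Adj v (s v) := by
  obtain ⟨m, ⟨e⟩⟩ := isEdgeOrCycle_iff.1 h
  refine ⟨fun v => e.symm (e v + 1), fun v w hvw => ?_, fun v => ?_⟩
  · exact e.injective (add_right_cancel (e.symm.injective hvw))
  · rw [← e.map_adj_iff, e.apply_symm_apply, SimpleGraph.cycleGraph_adj]
    exact Or.inr (add_sub_cancel_left _ _)

theorem IsPerfectOneTwoFactor.exists_injective {V : Type*} {G H : SimpleGraph V}
    (h : IsPerfectOneTwoFactor G H) :
    ∃ s : V → V, Function.Injective s ∧ ∀ v, G.Adj v (s v) := by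
  choose t ht ht' using fun C => (h.2 C).exists_injective
  let s : V → V := fun v => t (H.connectedComponentMk v) ⟨v, rfl⟩
  have hs : ∀ (C : H.ConnectedComponent) (v : V) (hv : v ∈ C), s v = t C ⟨v, hv⟩ := by
    rintro C v rfl
    rfl
  have hmem : ∀ v, s v ∈ H.connectedComponentMk v := fun v => (t _ ⟨v, rfl⟩).2
  refine ⟨s, fun v w hvw => ?_, fun v => h.1 (ht' _ ⟨v, rfl⟩)⟩
  have hv : H.connectedComponentMk (s v) = H.connectedComponentMk v := hmem v
  have hw : H.connectedComponentMk (s w) = H.connectedComponentMk w := hmem w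
  have hwv : H.connectedComponentMk w = H.connectedComponentMk v := by rw [← hw, ← hvw, hv]
  rw [hs _ v rfl, hs _ w hwv] at hvw
  exact congrArg Subtype.val (ht _ (Subtype.ext hvw))

/-- The functional graph of a fixed-point free map. -/
def functionalGraph {V : Type*} (s : V → V) (hs : ∀ v, s v ≠ v) : SimpleGraph V where
  Adj u v := s u = v ∨ s v = u
  symm := ⟨fun _ _ h => h.symm⟩
  loopless := ⟨fun v h => h.elim (hs v) (hs v)⟩

theorem isEdgeOrCycle_functionalGraph {V : Type*} [Finite V] {s : V → V}
    (hinj : Function.Injective s) (hs : ∀ v, s v ≠ v)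
    (C : (functionalGraph s hs).ConnectedComponent) : IsEdgeOrCycle C.toSimpleGraph := by
  induction C using SimpleGraph.ConnectedComponent.ind with
  | h v =>
  have hpos : 0 < Function.minimalPeriod s v :=
    Function.minimalPeriod_pos_of_mem_periodicPts (hinj.mem_periodicPts v)
  have hne1 : Function.minimalPeriod s v ≠ 1 := fun h =>
    hs v (Function.minimalPeriod_eq_one_iff_isFixedPt.1 h)
  obtain ⟨m, hm⟩ : ∃ m, Function.minimalPeriod s v = m + 2 :=
    ⟨Function.minimalPeriod s v - 2, by omega⟩
  have hper : s^[m + 2] v = v := hm ▸ Function.iterate_minimalPeriod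
  have hreach : ∀ i, (functionalGraph s hs).Reachable v (s^[i] v) := by
    intro i
    induction i with
    | zero => exact .refl _
    | succ i ih =>
      rw [Function.iterate_succ_apply']
      exact ih.trans (SimpleGraph.Adj.reachable (Or.inl rfl))
  have hmod : ∀ i, s^[i % (m + 2)] v = s^[i] v := fun i =>
    hm ▸ Function.iterate_mod_minimalPeriod_eq
  have hsurj : ∀ w, (functionalGraph s hs).Reachable v w → ∃ i, s^[i] v = w := by
    rintro w ⟨p⟩
    induction p using SimpleGraph.Walk.concatRec with
    | Hnil => exact ⟨0, rfl⟩
    | @Hconcat u w x q h ih =>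
      obtain ⟨i, hi⟩ := ih hpos hne1 hm hper hreach hmod
      rcases h with h | h
      · exact ⟨i + 1, by rw [Function.iterate_succ_apply', hi, h]⟩
      · refine ⟨i + (m + 1), hinj ?_⟩
        rw [h, ← Function.iterate_succ_apply' s, Nat.succ_eq_add_one, add_assoc,
          Function.iterate_add_apply, hper, hi]
  let φ : Fin (m + 2) → (functionalGraph s hs).connectedComponentMk v := fun i =>
    ⟨s^[i] v, (SimpleGraph.ConnectedComponent.eq.2 (hreach i)).symm⟩
  have hφinj : Function.Injective φ := by
    intro i j h
    have h' : s^[(i : ℕ)] v = s^[(j : ℕ)] v := congrArg Subtype.val h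
    exact Fin.ext (Function.iterate_injOn_Iio_minimalPeriod (by simp [hm, i.2])
      (by simp [hm, j.2]) h')
  have hφsurj : Function.Surjective φ := by
    rintro ⟨w, hw⟩
    obtain ⟨i, rfl⟩ := hsurj w (SimpleGraph.ConnectedComponent.eq.1 hw).symm
    exact ⟨⟨i % (m + 2), Nat.mod_lt _ (by omega)⟩, Subtype.ext (hmod i)⟩
  have hsucc : ∀ i, s (φ i) = φ (i + 1) := by
    intro i
    change s (s^[(i : ℕ)] v) = s^[((i + 1 : Fin (m + 2)) : ℕ)] v
    rw [Fin.val_add, Fin.val_one, hmod, Function.iterate_succ_apply']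
  have hstep : ∀ i j, s (φ i) = φ j ↔ j - i = 1 := by
    intro i j
    rw [hsucc, Subtype.coe_inj, hφinj.eq_iff, sub_eq_iff_eq_add', eq_comm]
  refine isEdgeOrCycle_iff.2 ⟨m, ⟨SimpleGraph.Iso.symm
    { toEquiv := Equiv.ofBijective φ ⟨hφinj, hφsurj⟩, map_rel_iff' := ?_ }⟩⟩
  intro i j
  change (s (φ i) = φ j ∨ s (φ j) = φ i) ↔ _
  rw [hstep, hstep, SimpleGraph.cycleGraph_adj, or_comm]

theorem exists_isPerfectOneTwoFactor_iff {V : Type*} [Finite V] {G : SimpleGraph V} :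
    (∃ H, IsPerfectOneTwoFactor G H) ↔
      ∃ s : V → V, Function.Injective s ∧ ∀ v, G.Adj v (s v) := by
  constructor
  · rintro ⟨H, hH⟩
    exact hH.exists_injective
  · rintro ⟨s, hinj, hs⟩
    refine ⟨functionalGraph s fun v => (hs v).ne', ?_, isEdgeOrCycle_functionalGraph hinj _⟩
    rintro u v (rfl | rfl)
    · exact hs _
    · exact (hs _).symm

/-! ### Outcome of the game on outerplanar graphs -/

theorem outcome_eq_D_iff {V : Type*} [DecidableEq V] {G : SimpleGraph V} :
    outcome G = Outcome.D ↔
      DominatorWins G Player.dominator ∅ ∅ ∧ DominatorWins G Player.staller ∅ ∅ := by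
  unfold outcome
  split_ifs with h1 h2 <;> simp [h1]

theorem mainTheorem2 {V : Type*} [Fintype V] [DecidableEq V] (G : SimpleGraph V)
    (hG : IsOuterplanar G) :
    outcome G = Outcome.D ↔ ∃ H : SimpleGraph V, IsPerfectOneTwoFactor G H := by
  rw [outcome_eq_D_iff, exists_isPerfectOneTwoFactor_iff]
  constructor
  · exact fun h => exists_injective_of_dominatorWins hG.noThetaAt h.2
  · rintro ⟨s, hs, hadj⟩
    exact ⟨dominatorWins_of_injective hs hadj _, dominatorWins_of_injective hs hadj _⟩
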